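/- For $p\in(0,1)$ let $\mu_p$ be the distribution on $\{0,1\}$ with mass $p$ at $1$ and mass $1-p$ at $0$. For an integer $k\ge 1$ let $\mathcal D(p,k)$ be the class of probability distributions $\nu$ on $\{0,1\}^k$ such that every coordinate has marginal $\mu_p$ and every $x$ in the support of $\nu$ satisfies $\sum_{i=1}^k x_i\equiv 0 \pmod 2$. A coordinate $i\in[k]$ of $\nu\in\mathcal D(p,k)$ is called pairwise independent if $\mathbb E_{X\sim\nu}[X_iX_j]=p^2$ for every $j\in[k]$, $j\ne i$. For $S\subseteq[n]$ let $\chi_S(x)=\prod_{j\in S}(-1)^{x_j}$ for $x\in\{0,1\}^n$. A sample $X\sim\nu^{\otimes n}$ consists of $n$ independent vectors $X^{(1)},\dots,X^{(n)}\sim\nu$, and for $i\in[k]$ we write $X_i=(X_i^{(1)},\dots,X_i^{(n)})\in\{0,1\}^n$. **Theorem.** Let $k\ge 1$ be an integer, $p\in(0,1)$, and let $\nu\in\mathcal D(p,k)$ have no pairwise independent coordinate. Then there exist a constant $\alpha>0$ and a sequence $\varepsilon_n\to 0$ (both may depend on $k$, $p$, $\nu$) such that for every sufficiently large $n\in\mathbb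 N$ there exists a function $f:\{0,1\}^n\to[-1,1]$ with 1. $\left|\mathbb E_{X\sim\nu^{\otimes n}}\left[\prod_{i=1}^k f(X_i)\right]\right|\ge\alpha$; 2. $\left|\mathbb E_{X\sim\mu_p^{\otimes n}}\left[f(X)\chi_S(X)\right]\right|\le\varepsilon_n$ for every $S\subseteq[n]$. Moreover, if $\Pr_{X\sim\nu}[X_i=X_j]<1$ for all $i\ne j$ in $[k]$ (that is, no two coordinates are almost surely equal), then the above holds, for some $\alpha>0$ and $\varepsilon_n\to 0$, with functions $f$ with values in $\{-1,1\}$. -/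

import Mathlib

open MeasureTheory Filter Topology

noncomputable section

namespace LinTest

/-- The `p`-biased distribution `μ_p` on `{0,1}`: mass `p` at `1` and mass `1 - p` at `0`. -/
def biased (p : ℝ) : Measure (Fin 2) :=
  ENNReal.ofReal p • Measure.dirac 1 + ENNReal.ofReal (1 - p) • Measure.dirac 0

/-- The class `𝒟(p,k)`: probability distributions on `{0,1}^k` all of whose coordinates have
marginal `μ_p`, and whose support consists of points of even weight. -/
structure MemD (p : ℝ) (k : ℕ) (ν : Measure (Fin k → Fin 2)) : Prop where
  isProbabilityMeasure : IsProbabilityMeasure ν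
  marginal : ∀ i : Fin k, ν.map (fun x => x i) = biased p
  support_even : ∀ x : Fin k → Fin 2, ν {x} ≠ 0 → Even (∑ i, (x i : ℕ))

/-- `i` is a pairwise independent coordinate of `ν` (in the class `𝒟(p,k)`):
`E[X_i X_j] = p ^ 2` for every `j ≠ i`. -/
def IsPairwiseIndepCoord (p : ℝ) {k : ℕ} (ν : Measure (Fin k → Fin 2)) (i : Fin k) : Prop :=
  ∀ j : Fin k, j ≠ i → ∫ x, ((x i : ℕ) : ℝ) * ((x j : ℕ) : ℝ) ∂ν = p ^ 2

/-- The linear function `χ_S(x) = ∏_{j ∈ S} (-1)^{x_j}`. -/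
def chi {n : ℕ} (S : Finset (Fin n)) (x : Fin n → Fin 2) : ℝ :=
  ∏ j ∈ S, (-1 : ℝ) ^ (x j : ℕ)

/-- The expectation of `∏ i, f (X_i)` over `X ∼ ν^{⊗n}`. A sample is a family `x` of `n`
independent rows `x j ∼ ν`, and `X_i` is the vector `j ↦ x j i` in `{0,1}^n`. -/
def testValue {k n : ℕ} (ν : Measure (Fin k → Fin 2)) (f : (Fin n → Fin 2) → ℝ) : ℝ :=
  ∫ x : Fin n → Fin k → Fin 2, ∏ i : Fin k, f (fun j => x j i) ∂(Measure.pi fun _ : Fin n => ν)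

/-- The correlation of `f` with `χ_S` under `μ_p^{⊗n}`. -/
def correlation (p : ℝ) {n : ℕ} (f : (Fin n → Fin 2) → ℝ) (S : Finset (Fin n)) : ℝ :=
  ∫ x : Fin n → Fin 2, f x * chi S x ∂(Measure.pi fun _ : Fin n => biased p)

/-- For some constant `α > 0` and some error `ε n → 0`, for every large `n` there is a function
`f` on `{0,1}^n` with values in `R` whose test value has absolute value at least `α`, while its
correlation with each `χ_S` is at most `ε n` in absolute value. -/
def FailsWithRange (p : ℝ) {k : ℕ} (ν : Measure (Fin k → Fin 2)) (R : Set ℝ) : Prop :=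
  ∃ α : ℝ, 0 < α ∧ ∃ ε : ℕ → ℝ, Tendsto ε atTop (𝓝 0) ∧ ∃ N : ℕ, ∀ n : ℕ, N ≤ n →
    ∃ f : (Fin n → Fin 2) → ℝ, (∀ x, f x ∈ R) ∧ α ≤ |testValue ν f| ∧
      ∀ S : Finset (Fin n), |correlation p f S| ≤ ε n

end LinTest

end

noncomputable section
namespace LinTest

/-! The support of `ν` is even, so `∏ i, χ_[n](X_i) = 1`: multiplying `f` by the full character
leaves the test value unchanged and turns the correlation with `χ_S` into the correlation of the
untwisted function with the character of the complement. It therefore suffices to find functions `h`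
with small correlation with every character, the constant included, and a large product expectation.

The building block is the centred cosine of the normalized sum of a block of coordinates (`hfun`).
Its correlation with any character of a block of size `N` is `O(1/√N)`, uniformly
(`exists_abs_pmean_hfun_mul_le`). By the central limit theorem, its pair correlation at `X_i, X_j`
tends to `exp(-p(1-p)) (cosh τ - 1)`, with `τ` the covariance of the coordinates
(`MemD.tendsto_pairCorr`). This limit is nonnegative whatever the sign of `τ`, and positive if `τ ≠
0`.

Each coordinate `e` has a neighbour `nb e ≠ e` of nonzero covariance. Split `[n]` into `k` blocks
and let `g_i` be the product of the cosines of the blocks `e` with `i ∈ {e, nb e}`. Then `E ∏ g_{σ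
i}(X_i)` factors into one pair correlation per block, so in the limit no permutation `σ` contributes
negatively and the identity contributes positively. Polarization yields signs for which the single
function `∑ ± g_i`, normalized and twisted by `χ_[n]`, has a test value at least as large as the
average of the signed test values.

For sign values, `f` is rounded independently at each point with mean `f`. The mean test value
changes only through samples with `X_i = X_j` for some `i ≠ j`, which are exponentially rare if no
two coordinates agree almost surely; a Chernoff bound and a union bound over the `2^n` characters
control all correlations. -/

/-- The expectation of `F` under the product weight `∏ j, w (x j)` on `J → A`. -/
def pmean {J A : Type*} [Fintype J] [DecidableEq J] [Fintype A] (w : A → ℝ)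
    (F : (J → A) → ℝ) : ℝ :=
  ∑ x : J → A, (∏ j, w (x j)) * F x

theorem sum_pi_prod {J A R : Type*} [Fintype J] [DecidableEq J] [Fintype A] [CommSemiring R]
    (u : J → A → R) : ∑ x : J → A, ∏ j, u j (x j) = ∏ j, ∑ a, u j a := by
  rw [Finset.prod_univ_sum, Fintype.piFinset_univ]

/-! ### Expectations under finite product weights -/

section pmean

variable {J A : Type*} [Fintype J] [DecidableEq J] [Fintype A] {w : A → ℝ}

theorem pmean_prod (u : J → A → ℝ) :
    pmean w (fun x => ∏ j, u j (x j)) = ∏ j, ∑ a, w a * u j a := by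
  simp only [pmean, ← Finset.prod_mul_distrib]
  exact sum_pi_prod fun j a => w a * u j a

theorem pmean_const (hw : ∑ a, w a = 1) (c : ℝ) : pmean (J := J) w (fun _ => c) = c := by
  simp only [pmean, ← Finset.sum_mul]
  rw [sum_pi_prod (fun _ a => w a)]
  simp [hw]

theorem pmean_add (F G : (J → A) → ℝ) :
    pmean w (fun x => F x + G x) = pmean w F + pmean w G := by
  simp [pmean, mul_add, Finset.sum_add_distrib]

theorem pmean_sub (F G : (J → A) → ℝ) :
    pmean w (fun x => F x - G x) = pmean w F - pmean w G := by
  simp [pmean, mul_sub, Finset.sum_sub_distrib]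

theorem pmean_const_mul (c : ℝ) (F : (J → A) → ℝ) :
    pmean w (fun x => c * F x) = c * pmean w F := by
  simp only [pmean, Finset.mul_sum]
  exact Finset.sum_congr rfl fun _ _ => by ring

theorem pmean_sum {ι : Type*} (s : Finset ι) (F : ι → (J → A) → ℝ) :
    pmean w (fun x => ∑ i ∈ s, F i x) = ∑ i ∈ s, pmean w (F i) := by
  simp only [pmean, Finset.mul_sum]
  exact Finset.sum_comm

theorem pmean_mono (h0 : ∀ a, 0 ≤ w a) {F G : (J → A) → ℝ} (h : ∀ x, F x ≤ G x) :
    pmean w F ≤ pmean w G :=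
  Finset.sum_le_sum fun x _ =>
    mul_le_mul_of_nonneg_left (h x) (Finset.prod_nonneg fun _ _ => h0 _)

theorem pmean_congr {F G : (J → A) → ℝ} (h : ∀ x, (∀ j, w (x j) ≠ 0) → F x = G x) :
    pmean w F = pmean w G := by
  refine Finset.sum_congr rfl fun x _ => ?_
  by_cases hx : ∀ j, w (x j) ≠ 0
  · rw [h x hx]
  · push Not at hx
    obtain ⟨j, hj⟩ := hx
    rw [Finset.prod_eq_zero (Finset.mem_univ j) hj]
    simp

theorem abs_pmean_le (h0 : ∀ a, 0 ≤ w a) (F : (J → A) → ℝ) :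
    |pmean w F| ≤ pmean w (fun x => |F x|) := by
  refine (Finset.abs_sum_le_sum_abs _ _).trans (le_of_eq (Finset.sum_congr rfl fun x _ => ?_))
  rw [abs_mul, abs_of_nonneg (Finset.prod_nonneg fun _ _ => h0 _)]

theorem abs_pmean_le_of_le (h0 : ∀ a, 0 ≤ w a) (hw : ∑ a, w a = 1) {F : (J → A) → ℝ} {c : ℝ}
    (h : ∀ x, |F x| ≤ c) : |pmean w F| ≤ c :=
  (abs_pmean_le h0 F).trans ((pmean_mono h0 h).trans_eq (pmean_const hw c))

/-- Functions of disjoint blocks of coordinates are independent. -/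
theorem pmean_prod_blocks {E : Type*} [Fintype E] [DecidableEq E] (b : J → E)
    (Φ : ∀ e, ({j // b j = e} → A) → ℝ) :
    pmean w (fun x : J → A => ∏ e, Φ e (fun j : {j // b j = e} => x j)) = ∏ e, pmean w (Φ e) := by
  simp only [pmean]
  rw [Finset.prod_univ_sum, Fintype.piFinset_univ]
  let eqv : (J → A) ≃ (∀ e, {j // b j = e} → A) :=
    ((Equiv.sigmaFiberEquiv b).symm.arrowCongr (Equiv.refl A)).trans (Equiv.piCurry fun _ _ => A)
  refine Fintype.sum_equiv eqv _ _ fun x => ?_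
  have h : ∀ e (j : {j // b j = e}), eqv x e j = x j := fun e j => rfl
  rw [Finset.prod_mul_distrib]
  congr 1
  simp only [h]
  rw [← (Equiv.sigmaFiberEquiv b).prod_comp, Fintype.prod_sigma]
  rfl

end pmean

/-! ### From measures to finite weights -/

/-- The mass function of `μ_p`. -/
def bw (p : ℝ) (a : Fin 2) : ℝ := if a = 1 then p else 1 - p

theorem sum_bw (p : ℝ) : ∑ a, bw p a = 1 := by simp [bw]

theorem bw_nonneg {p : ℝ} (hp0 : 0 < p) (hp1 : p < 1) (a : Fin 2) : 0 ≤ bw p a := by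
  unfold bw; split <;> linarith

theorem integral_pi_eq_pmean {n : ℕ} {A : Type*} [Fintype A] [MeasurableSpace A]
    [MeasurableSingletonClass A] (μ : Measure A) [IsProbabilityMeasure μ]
    (F : (Fin n → A) → ℝ) :
    ∫ x, F x ∂(Measure.pi fun _ : Fin n => μ) = pmean (fun a => μ.real {a}) F := by
  classical
  rw [integral_fintype .of_finite]
  refine Finset.sum_congr rfl fun x _ => ?_
  rw [smul_eq_mul, measureReal_def, Measure.pi_singleton, ENNReal.toReal_prod]
  rfl

theorem isProbabilityMeasure_biased {p : ℝ} (hp0 : 0 < p) (hp1 : p < 1) :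
    IsProbabilityMeasure (biased p) := by
  constructor
  simp only [biased, Measure.add_apply, Measure.smul_apply, measure_univ, smul_eq_mul, mul_one]
  rw [← ENNReal.ofReal_add hp0.le (by linarith)]
  simp

theorem biased_real_singleton {p : ℝ} (hp0 : 0 < p) (hp1 : p < 1) (a : Fin 2) :
    (biased p).real {a} = bw p a := by
  fin_cases a
  · simp [biased, bw, measureReal_def, hp1.le]
  · simp [biased, bw, measureReal_def, hp0.le]

theorem correlation_eq_pmean {p : ℝ} (hp0 : 0 < p) (hp1 : p < 1) {n : ℕ}
    (f : (Fin n → Fin 2) → ℝ) (S : Finset (Fin n)) :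
    correlation p f S = pmean (bw p) (fun x => f x * chi S x) := by
  have := isProbabilityMeasure_biased hp0 hp1
  rw [correlation, integral_pi_eq_pmean]
  simp only [biased_real_singleton hp0 hp1]

section weights

variable {k : ℕ} {p : ℝ} {ν : Measure (Fin k → Fin 2)}

theorem testValue_eq_pmean {n : ℕ} [IsProbabilityMeasure ν] (f : (Fin n → Fin 2) → ℝ) :
    testValue ν f =
      pmean (fun y => ν.real {y}) (fun x => ∏ i : Fin k, f (fun j => x j i)) := by
  rw [testValue, integral_pi_eq_pmean]

theorem sum_real_singleton {A : Type*} [Fintype A] [MeasurableSpace A]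
    [MeasurableSingletonClass A] (μ : Measure A) [IsProbabilityMeasure μ] :
    ∑ y, μ.real {y} = 1 := by
  rw [sum_measureReal_singleton]; simp

theorem MemD.sum_marginal (hν : MemD p k ν) (hp0 : 0 < p) (hp1 : p < 1) (i : Fin k)
    {E : Type*} [NormedAddCommGroup E] [NormedSpace ℝ E] [CompleteSpace E] (G : Fin 2 → E) :
    ∑ y, ν.real {y} • G (y i) = ∑ a, bw p a • G a := by
  have := hν.isProbabilityMeasure
  have := isProbabilityMeasure_biased hp0 hp1
  rw [← integral_fintype (f := fun y : Fin k → Fin 2 => G (y i)) .of_finite,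
    ← integral_map (φ := fun y : Fin k → Fin 2 => y i) (f := G) (measurable_pi_apply i).aemeasurable
      (by rw [hν.marginal]; exact Integrable.of_finite.aestronglyMeasurable),
    hν.marginal, integral_fintype .of_finite]
  simp only [biased_real_singleton hp0 hp1]

end weights

/-! ### Characteristic functions and the central limit theorem -/

/-- The characteristic function of `u` under the weight `w`. -/
def charW {A : Type*} [Fintype A] (w u : A → ℝ) (s : ℝ) : ℂ :=
  ∑ a, (w a : ℂ) * Complex.exp (Complex.I * ((s * u a : ℝ) : ℂ))

section charW

variable {J A : Type*} [Fintype J] [DecidableEq J] [Fintype A] {w : A → ℝ}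

/-- The cosine is the real part of an exponential, and the exponential of a sum factors over
independent coordinates. -/
theorem pmean_cos_mul_prod (u : A → ℝ) (s : ℝ) (v : J → A → ℝ) :
    pmean w (fun x => Real.cos (s * ∑ j, u (x j)) * ∏ j, v j (x j)) =
      (∏ j, ∑ a, ((w a * v j a : ℝ) : ℂ) * Complex.exp (Complex.I * ((s * u a : ℝ) : ℂ))).re := by
  rw [← sum_pi_prod (fun j a =>
    ((w a * v j a : ℝ) : ℂ) * Complex.exp (Complex.I * ((s * u a : ℝ) : ℂ))), Complex.re_sum]
  refine Finset.sum_congr rfl fun x _ => ?_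
  rw [Finset.prod_mul_distrib, ← Complex.exp_sum, ← Complex.ofReal_prod, ← Finset.mul_sum,
    ← Complex.ofReal_sum, ← Finset.mul_sum, mul_comm Complex.I, Complex.re_ofReal_mul,
    Complex.exp_ofReal_mul_I_re, Finset.prod_mul_distrib]
  ring

theorem pmean_cos (u : A → ℝ) (s : ℝ) :
    pmean (J := J) w (fun x => Real.cos (s * ∑ j, u (x j))) =
      (charW w u s ^ Fintype.card J).re := by
  have := pmean_cos_mul_prod (J := J) (w := w) u s (fun _ _ => 1)
  simpa [charW] using this

/-- Second-order Taylor expansion: with `s = 1/√n`, the cubic remainder times `n` is at most `n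
(s|t|)^3 = s|t|^3`. -/
theorem tendsto_nat_mul_exp_sub (t : ℝ) :
    Tendsto (fun n : ℕ => (n : ℂ) * (Complex.exp (Complex.I * (((1 / √(n : ℝ)) * t : ℝ) : ℂ)) - 1
      - Complex.I * (((1 / √(n : ℝ)) * t : ℝ) : ℂ))) atTop (𝓝 (-(t ^ 2 : ℝ) / 2 : ℂ)) := by
  have hs : Tendsto (fun n : ℕ => 1 / √(n : ℝ)) atTop (𝓝 0) := by
    simpa [Function.comp_def, Pi.inv_def] using
      (Real.tendsto_sqrt_atTop.comp tendsto_natCast_atTop_atTop).inv_tendsto_atTop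
  have hst : Tendsto (fun n : ℕ => 1 / √(n : ℝ) * |t|) atTop (𝓝 0) := by
    simpa using hs.mul_const |t|
  rw [tendsto_iff_norm_sub_tendsto_zero]
  refine squeeze_zero' (g := fun n : ℕ => (1 / √(n : ℝ)) * |t| ^ 3) (.of_forall fun _ => norm_nonneg _)
    ?_ (by simpa using hs.mul_const (|t| ^ 3))
  filter_upwards [hst.eventually_le_const one_pos, eventually_gt_atTop 0] with n hn hn0
  have hn0' : (0 : ℝ) < n := by exact_mod_cast hn0
  set s := 1 / √(n : ℝ) with hsdef
  have hs0 : 0 < s := by positivity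
  have hns : (n : ℝ) * s ^ 2 = 1 := by
    rw [hsdef, div_pow, Real.sq_sqrt hn0'.le]; field_simp
  set z : ℂ := Complex.I * ((s * t : ℝ) : ℂ) with hz
  have hzn : ‖z‖ = s * |t| := by
    rw [hz, norm_mul, Complex.norm_I, one_mul, Complex.norm_real, Real.norm_eq_abs, abs_mul,
      abs_of_pos hs0]
  have hb := Complex.exp_bound (x := z) (by rw [hzn]; exact hn) (n := 3) (by norm_num)
  have hz2 : (n : ℂ) * z ^ 2 = -(t ^ 2 : ℝ) := by
    have : (n : ℂ) * (s : ℂ) ^ 2 = 1 := by exact_mod_cast hns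
    rw [hz, mul_pow, Complex.I_sq]
    push_cast
    linear_combination (-(t : ℂ) ^ 2) * this
  have heq : (n : ℂ) * (Complex.exp z - 1 - z) - -(t ^ 2 : ℝ) / 2 =
      n * (Complex.exp z - ∑ m ∈ Finset.range 3, z ^ m / (m.factorial : ℂ)) := by
    simp only [Finset.sum_range_succ, Finset.sum_range_zero, Nat.factorial]
    push_cast
    push_cast at hz2
    linear_combination (1 / 2 : ℂ) * hz2
  rw [heq, norm_mul, Complex.norm_natCast]
  calc (n : ℝ) * ‖Complex.exp z - ∑ m ∈ Finset.range 3, z ^ m / (m.factorial : ℂ)‖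
      ≤ n * (‖z‖ ^ 3 * 1) := by
        refine mul_le_mul_of_nonneg_left (hb.trans ?_) hn0'.le
        gcongr
        norm_num [Nat.factorial]
    _ = s * |t| ^ 3 := by
        rw [hzn]
        linear_combination (s * |t| ^ 3) * hns

/-- Total mass one and mean zero cancel the terms of order zero and one, so `(1 + z_n / n)^n` with
`z_n → -variance/2` remains. -/
theorem tendsto_charW_pow (hw : ∑ a, w a = 1) (u : A → ℝ) (hu : ∑ a, w a * u a = 0) :
    Tendsto (fun n : ℕ => (charW w u (1 / √(n : ℝ)) ^ n).re) atTop
      (𝓝 (Real.exp (-(∑ a, w a * u a ^ 2) / 2))) := by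
  have key : Tendsto (fun n : ℕ => (n : ℂ) * (charW w u (1 / √(n : ℝ)) - 1)) atTop
      (𝓝 ((-(∑ a, w a * u a ^ 2) / 2 : ℝ) : ℂ)) := by
    have h := tendsto_finsetSum Finset.univ fun a (_ : a ∈ Finset.univ) =>
      (tendsto_nat_mul_exp_sub (u a)).const_mul (w a : ℂ)
    convert h using 2 with n
    · have h1 : ∑ a, (w a : ℂ) = 1 := by exact_mod_cast hw
      have h2 : ∑ a, (w a : ℂ) * (u a : ℂ) = 0 := by exact_mod_cast hu
      have e1 : charW w u (1 / √(n : ℝ)) - 1 = charW w u (1 / √(n : ℝ)) - ∑ a, (w a : ℂ)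
          - Complex.I * ((1 / √(n : ℝ) : ℝ) : ℂ) * ∑ a, (w a : ℂ) * (u a : ℂ) := by
        rw [h1, h2]; ring
      rw [e1, charW, Finset.mul_sum Finset.univ _ (Complex.I * _), ← Finset.sum_sub_distrib,
        ← Finset.sum_sub_distrib, Finset.mul_sum]
      refine Finset.sum_congr rfl fun a _ => ?_
      push_cast
      ring
    · push_cast
      rw [neg_div, Finset.sum_div, ← Finset.sum_neg_distrib]
      exact Finset.sum_congr rfl fun a _ => by ring
  have h2 := (Complex.continuous_re.tendsto _).comp
    (Complex.tendsto_one_add_pow_exp_of_tendsto key)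
  rw [← Complex.ofReal_exp, Complex.ofReal_re] at h2
  simpa [Function.comp_def] using h2

theorem norm_charW_le (h0 : ∀ a, 0 ≤ w a) (hw : ∑ a, w a = 1) (u : A → ℝ) (s : ℝ) :
    ‖charW w u s‖ ≤ 1 := by
  refine (norm_sum_le _ _).trans (le_of_eq ?_)
  rw [← hw]
  refine Finset.sum_congr rfl fun a _ => ?_
  rw [norm_mul, mul_comm Complex.I, Complex.norm_exp_ofReal_mul_I, mul_one, Complex.norm_real,
    Real.norm_of_nonneg (h0 a)]

end charW

/-! ### Correlation of the centred cosine with characters -/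

/-- The factor multiplying `a - b` is dominated by a geometric series, so the bound does not grow
with the exponent. -/
theorem norm_pow_sub_pow_le_geom {a b : ℂ} {r : ℝ} (hr : r < 1) (ha : ‖a‖ ≤ r) (hb : ‖b‖ ≤ r)
    (t : ℕ) : ‖a ^ t - b ^ t‖ ≤ ‖a - b‖ / (1 - r) := by
  have hr0 : 0 ≤ r := (norm_nonneg a).trans ha
  have h1 : ‖∑ i ∈ Finset.range t, a ^ i * b ^ (t - 1 - i)‖ ≤ 1 / (1 - r) := by
    calc _ ≤ ∑ i ∈ Finset.range t, ‖a ^ i * b ^ (t - 1 - i)‖ := norm_sum_le _ _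
      _ ≤ ∑ i ∈ Finset.range t, r ^ i := by
          refine Finset.sum_le_sum fun i _ => ?_
          rw [norm_mul, norm_pow, norm_pow]
          calc ‖a‖ ^ i * ‖b‖ ^ (t - 1 - i) ≤ r ^ i * 1 := by
                gcongr
                exact pow_le_one₀ (norm_nonneg _) (hb.trans hr.le)
            _ = r ^ i := mul_one _
      _ ≤ ∑' i, r ^ i := (summable_geometric_of_lt_one hr0 hr).sum_le_tsum _ fun _ _ => by positivity
      _ = 1 / (1 - r) := by rw [tsum_geometric_of_lt_one hr0 hr, one_div]
  rw [← geom_sum₂_mul a b t, norm_mul]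
  calc _ ≤ 1 / (1 - r) * ‖a - b‖ := by gcongr
    _ = ‖a - b‖ / (1 - r) := by ring

/-- The cosine of the normalized sum of the centred coordinates. -/
def cosSum (p : ℝ) {J : Type*} [Fintype J] (x : J → Fin 2) : ℝ :=
  Real.cos (1 / √(Fintype.card J : ℝ) * ∑ j, (((x j : ℕ) : ℝ) - p))

/-- The centred version of `cosSum`. -/
def hfun (p : ℝ) {J : Type*} [Fintype J] [DecidableEq J] (x : J → Fin 2) : ℝ :=
  cosSum p x - pmean (J := J) (bw p) (cosSum p)

section bias

variable {J : Type*} [Fintype J] [DecidableEq J] {p : ℝ}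

theorem abs_hfun_le (hp0 : 0 < p) (hp1 : p < 1) (x : J → Fin 2) : |hfun p x| ≤ 2 := by
  have h1 : |cosSum p x| ≤ 1 := Real.abs_cos_le_one _
  have h2 : |pmean (J := J) (bw p) (cosSum p)| ≤ 1 :=
    abs_pmean_le_of_le (bw_nonneg hp0 hp1) (sum_bw p) fun x => Real.abs_cos_le_one _
  exact (abs_sub _ _).trans (by linarith)

theorem norm_charW_bw_sub_le (hp0 : 0 < p) (hp1 : p < 1) {s : ℝ} (hs0 : 0 ≤ s) {c : Fin 2 → ℝ}
    (hc : ∀ a, |c a| ≤ bw p a) :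
    ‖charW c (fun a => ((a : ℕ) : ℝ) - p) s - ((∑ a, c a : ℝ) : ℂ)‖ ≤ s := by
  have hexp : ∀ a : Fin 2,
      ‖Complex.exp (Complex.I * ((s * (((a : ℕ) : ℝ) - p) : ℝ) : ℂ)) - 1‖ ≤ s := by
    intro a
    refine Real.norm_exp_I_mul_ofReal_sub_one_le.trans ?_
    rw [Real.norm_eq_abs, abs_mul, abs_of_nonneg hs0]
    refine mul_le_of_le_one_right hs0 ?_
    rw [abs_le]
    fin_cases a
    · constructor <;> norm_num <;> linarith
    · constructor <;> norm_num <;> linarith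
  rw [charW, Complex.ofReal_sum, ← Finset.sum_sub_distrib]
  calc _ ≤ ∑ a : Fin 2, bw p a * s := by
        refine (norm_sum_le _ _).trans (Finset.sum_le_sum fun a _ => ?_)
        rw [← mul_sub_one, norm_mul, Complex.norm_real, Real.norm_eq_abs]
        exact mul_le_mul (hc a) (hexp a) (norm_nonneg _) (bw_nonneg hp0 hp1 a)
    _ = s := by rw [← Finset.sum_mul, sum_bw, one_mul]

/-- The signed mass function `a ↦ (-1) ^ a * μ_p {a}`. -/
def signedW (p : ℝ) (a : Fin 2) : ℝ := bw p a * (-1) ^ (a : ℕ)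

theorem sum_signedW : ∑ a, signedW p a = 1 - 2 * p := by
  simp [bw, signedW]; ring

theorem prod_sign_eq (T : Finset J) (x : J → Fin 2) : ∏ j ∈ T, (-1 : ℝ) ^ (x j : ℕ) =
    ∏ j, if j ∈ T then (-1 : ℝ) ^ (x j : ℕ) else 1 := by
  rw [Finset.prod_ite_mem, Finset.univ_inter]

/-- By independence each coordinate in `T` contributes `ψ` and each other one `φ`; centring
subtracts `(1 - 2p)^|T|` times the mean of the cosine. -/
theorem pmean_hfun_mul_sign (T : Finset J) {φ ψ : ℂ}
    (hφ : φ = charW (bw p) (fun a => ((a : ℕ) : ℝ) - p) (1 / √(Fintype.card J : ℝ)))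
    (hψ : ψ = charW (signedW p) (fun a => ((a : ℕ) : ℝ) - p) (1 / √(Fintype.card J : ℝ))) :
    pmean (J := J) (bw p) (fun x => hfun p x * ∏ j ∈ T, (-1 : ℝ) ^ (x j : ℕ)) =
      ((ψ ^ T.card - (((1 - 2 * p : ℝ) : ℂ) * φ) ^ T.card) *
        φ ^ (Fintype.card J - T.card)).re := by
  have hc : pmean (J := J) (bw p) (cosSum p) = (φ ^ Fintype.card J).re := by
    rw [hφ]
    exact pmean_cos (w := bw p) (fun a : Fin 2 => ((a : ℕ) : ℝ) - p) (1 / √(Fintype.card J : ℝ))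
  have hcards : Fintype.card J = T.card + (Fintype.card J - T.card) := by
    have := T.card_le_univ; omega
  have h1 : pmean (J := J) (bw p) (fun x => cosSum p x * ∏ j ∈ T, (-1 : ℝ) ^ (x j : ℕ)) =
      (ψ ^ T.card * φ ^ (Fintype.card J - T.card)).re := by
    simp only [prod_sign_eq, cosSum]
    have := pmean_cos_mul_prod (J := J) (w := bw p) (fun a : Fin 2 => ((a : ℕ) : ℝ) - p)
      (1 / √(Fintype.card J : ℝ)) (fun j a => if j ∈ T then (-1 : ℝ) ^ (a : ℕ) else 1)
    refine this.trans (congrArg Complex.re ?_)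
    have hj : ∀ j, (∑ a : Fin 2, ((bw p a * (if j ∈ T then (-1 : ℝ) ^ (a : ℕ) else 1) : ℝ) : ℂ) *
        Complex.exp (Complex.I * ((1 / √(Fintype.card J : ℝ) * (((a : ℕ) : ℝ) - p) : ℝ) : ℂ))) =
        if j ∈ T then ψ else φ := by
      intro j
      split
      · rw [hψ]; rfl
      · rw [hφ]; simp only [mul_one]; rfl
    rw [Finset.prod_congr rfl fun j _ => hj j, Finset.prod_ite, Finset.prod_const,
      Finset.prod_const, Finset.filter_mem_eq_inter,
      Finset.univ_inter, Finset.filter_not, Finset.filter_mem_eq_inter, Finset.univ_inter,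
      Finset.card_sdiff_of_subset (Finset.subset_univ _), Finset.card_univ]
  have h2 : pmean (J := J) (bw p) (fun x => ∏ j ∈ T, (-1 : ℝ) ^ (x j : ℕ)) =
      (1 - 2 * p) ^ T.card := by
    simp only [prod_sign_eq]
    rw [pmean_prod (fun j (a : Fin 2) => if j ∈ T then (-1 : ℝ) ^ (a : ℕ) else 1)]
    have hj : ∀ j, ∑ a : Fin 2, bw p a * (if j ∈ T then (-1 : ℝ) ^ (a : ℕ) else 1) =
        if j ∈ T then 1 - 2 * p else 1 := by
      intro j
      split
      · exact sum_signedW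
      · simp only [mul_one]; exact sum_bw p
    rw [Finset.prod_congr rfl fun j _ => hj j, Finset.prod_ite_mem, Finset.univ_inter,
      Finset.prod_const]
  simp only [hfun, sub_mul, pmean_sub, pmean_const_mul]
  rw [h1, h2, hc, mul_comm _ ((1 - 2 * p) ^ T.card), ← Complex.re_ofReal_mul, Complex.sub_re]
  congr 2
  conv_lhs => rw [hcards, pow_add]
  rw [mul_pow]
  push_cast
  ring

/-- With `s = 1/√N` and `β = 1 - 2p`, both `ψ` and `βφ` are within `s` of `β`. Since `|β| < 1`, the
difference of their `t`-th powers is `O(s)` uniformly in `t`. -/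
theorem exists_abs_pmean_hfun_mul_le (hp0 : 0 < p) (hp1 : p < 1) :
    ∃ C : ℝ, ∀ (J : Type) [Fintype J] [DecidableEq J] (T : Finset J),
      |pmean (J := J) (bw p) (fun x => hfun p x * ∏ j ∈ T, (-1 : ℝ) ^ (x j : ℕ))| ≤
        C * (1 / √(Fintype.card J : ℝ)) := by
  -- `r` is the midpoint of `|1 - 2p|` and `1`; for `s ≤ 1 - r` both bases have norm at most `r`.
  -- For larger `s` the trivial bound `2` suffices.
  obtain ⟨r, hr1, hβr⟩ : ∃ r, r < 1 ∧ |1 - 2 * p| + (1 - r) ≤ r :=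
    ⟨(1 + |1 - 2 * p|) / 2,
      by linarith [show |1 - 2 * p| < 1 by rw [abs_lt]; constructor <;> linarith], by linarith⟩
  have hr1' : 0 < 1 - r := by linarith
  refine ⟨4 / (1 - r), fun J _ _ T => ?_⟩
  obtain ⟨s, hs⟩ : ∃ s, s = 1 / √(Fintype.card J : ℝ) := ⟨_, rfl⟩
  have hs0 : 0 ≤ s := by rw [hs]; positivity
  rcases lt_or_ge (1 - r) s with hsr | hsr
  · refine (abs_pmean_le_of_le (c := 2) (bw_nonneg hp0 hp1) (sum_bw p) fun x => ?_).trans ?_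
    · have h1 : |∏ j ∈ T, (-1 : ℝ) ^ (x j : ℕ)| ≤ 1 := by rw [Finset.abs_prod]; simp
      rw [abs_mul]
      nlinarith [abs_nonneg (hfun p x), abs_hfun_le hp0 hp1 x]
    · rw [← hs, div_mul_eq_mul_div, le_div_iff₀ hr1']
      linarith
  obtain ⟨φ, hφ⟩ : ∃ φ, φ = charW (bw p) (fun a => ((a : ℕ) : ℝ) - p) s := ⟨_, rfl⟩
  obtain ⟨ψ, hψ⟩ : ∃ ψ, ψ = charW (signedW p) (fun a => ((a : ℕ) : ℝ) - p) s := ⟨_, rfl⟩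
  obtain ⟨β, hβ⟩ : ∃ β : ℝ, β = 1 - 2 * p := ⟨_, rfl⟩
  rw [pmean_hfun_mul_sign T (hs ▸ hφ) (hs ▸ hψ), ← hs, ← hβ]
  rw [← hβ] at hβr
  have hφ1 : ‖φ‖ ≤ 1 := hφ ▸ norm_charW_le (bw_nonneg hp0 hp1) (sum_bw p) _ _
  have hφs : ‖φ - 1‖ ≤ s := by
    have := norm_charW_bw_sub_le hp0 hp1 hs0
      fun a => (abs_of_nonneg (bw_nonneg hp0 hp1 a)).le
    rwa [sum_bw, Complex.ofReal_one, ← hφ] at this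
  have hψs : ‖ψ - β‖ ≤ s := by
    have := norm_charW_bw_sub_le (c := signedW p) hp0 hp1 hs0 fun a => by
      rw [signedW, abs_mul, abs_of_nonneg (bw_nonneg hp0 hp1 a)]; simp
    rwa [sum_signedW, ← hψ, ← hβ] at this
  have hβn : ‖(β : ℂ)‖ = |β| := by rw [Complex.norm_real, Real.norm_eq_abs]
  have hβ1 : |β| ≤ 1 := by linarith
  have hψr : ‖ψ‖ ≤ r := by
    calc ‖ψ‖ = ‖(ψ - β) + β‖ := by ring_nf
      _ ≤ s + |β| := (norm_add_le _ _).trans (by rw [hβn]; gcongr)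
      _ ≤ r := by linarith
  have hβφ : ‖(β : ℂ) * φ‖ ≤ r := by
    rw [norm_mul, hβn]
    exact (mul_le_of_le_one_right (abs_nonneg β) hφ1).trans (by linarith)
  have hdiff : ‖ψ - β * φ‖ ≤ 2 * s := by
    calc ‖ψ - β * φ‖ = ‖(ψ - β) - β * (φ - 1)‖ := by ring_nf
      _ ≤ ‖ψ - β‖ + ‖(β : ℂ) * (φ - 1)‖ := norm_sub_le _ _
      _ ≤ s + 1 * s := by
          rw [norm_mul, hβn]; gcongr
      _ = 2 * s := by ring
  calc _ ≤ _ := Complex.abs_re_le_norm _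
    _ ≤ ‖ψ ^ T.card - (β * φ) ^ T.card‖ * 1 := by
        rw [norm_mul]
        gcongr
        rw [norm_pow]
        exact pow_le_one₀ (norm_nonneg _) hφ1
    _ ≤ 2 * s / (1 - r) := by
        rw [mul_one]
        refine (norm_pow_sub_pow_le_geom hr1 hψr hβφ _).trans ?_
        gcongr
    _ ≤ 4 / (1 - r) * s := by
        rw [div_mul_eq_mul_div]
        gcongr
        linarith

end bias

/-! ### Pair correlations and covariances -/

section covariance

variable {k : ℕ} {p : ℝ} {ν : Measure (Fin k → Fin 2)}

/-- The `i`-th coordinate, centred. -/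
def cent (p : ℝ) {k : ℕ} (i : Fin k) (y : Fin k → Fin 2) : ℝ := ((y i : ℕ) : ℝ) - p

/-- The covariance of two coordinates of `ν`. -/
def covW (p : ℝ) (ν : Measure (Fin k → Fin 2)) (i j : Fin k) : ℝ :=
  ∑ y, ν.real {y} * (cent p i y * cent p j y)

/-- The value of `E[h(X_i) h(X_j)]` over `N` samples, for `h = hfun p`. -/
def pairCorr (p : ℝ) (ν : Measure (Fin k → Fin 2)) (i j : Fin k) (N : ℕ) : ℝ :=
  ((charW (fun y => ν.real {y}) (fun y => cent p i y + cent p j y) (1 / √(N : ℝ)) ^ N).re +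
    (charW (fun y => ν.real {y}) (fun y => cent p i y - cent p j y) (1 / √(N : ℝ)) ^ N).re) / 2 -
  (charW (bw p) (fun a : Fin 2 => ((a : ℕ) : ℝ) - p) (1 / √(N : ℝ)) ^ N).re ^ 2

theorem MemD.sum_marginal_mul (hν : MemD p k ν) (hp0 : 0 < p) (hp1 : p < 1) (i : Fin k)
    (G : Fin 2 → ℝ) : ∑ y, ν.real {y} * G (y i) = ∑ a, bw p a * G a :=
  hν.sum_marginal hp0 hp1 i G

theorem MemD.sum_mul_cent (hν : MemD p k ν) (hp0 : 0 < p) (hp1 : p < 1) (i : Fin k) :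
    ∑ y, ν.real {y} * cent p i y = 0 := by
  refine (hν.sum_marginal_mul hp0 hp1 i fun a => ((a : ℕ) : ℝ) - p).trans ?_
  simp [bw]
  ring

theorem MemD.covW_self (hν : MemD p k ν) (hp0 : 0 < p) (hp1 : p < 1) (i : Fin k) :
    covW p ν i i = p * (1 - p) := by
  refine (hν.sum_marginal_mul hp0 hp1 i
    fun a => (((a : ℕ) : ℝ) - p) * (((a : ℕ) : ℝ) - p)).trans ?_
  simp [bw]
  ring

theorem MemD.covW_eq (hν : MemD p k ν) (hp0 : 0 < p) (hp1 : p < 1) (i j : Fin k) :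
    covW p ν i j = ∫ x, ((x i : ℕ) : ℝ) * ((x j : ℕ) : ℝ) ∂ν - p ^ 2 := by
  have := hν.isProbabilityMeasure
  rw [integral_fintype .of_finite]
  have h1 := hν.sum_mul_cent hp0 hp1 i
  have h2 := hν.sum_mul_cent hp0 hp1 j
  have h3 := sum_real_singleton ν
  have e : ∀ y : Fin k → Fin 2, ν.real {y} * (cent p i y * cent p j y) =
      ν.real {y} • (((y i : ℕ) : ℝ) * ((y j : ℕ) : ℝ)) - p * (ν.real {y} * cent p i y)
        - p * (ν.real {y} * cent p j y) - p ^ 2 * ν.real {y} := by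
    intro y; simp only [cent, smul_eq_mul]; ring
  rw [covW, Finset.sum_congr rfl fun y _ => e y, Finset.sum_sub_distrib, Finset.sum_sub_distrib,
    Finset.sum_sub_distrib, ← Finset.mul_sum, ← Finset.mul_sum, ← Finset.mul_sum, h1, h2, h3]
  ring

theorem MemD.charW_marginal (hν : MemD p k ν) (hp0 : 0 < p) (hp1 : p < 1) (i : Fin k) (s : ℝ) :
    charW (fun y => ν.real {y}) (cent p i) s =
      charW (bw p) (fun a : Fin 2 => ((a : ℕ) : ℝ) - p) s := by
  have := hν.sum_marginal hp0 hp1 i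
    fun a => Complex.exp (Complex.I * ((s * (((a : ℕ) : ℝ) - p) : ℝ) : ℂ))
  simpa only [Complex.real_smul, charW, cent] using this

variable {J : Type*} [Fintype J] [DecidableEq J]

theorem MemD.pmean_hfun_mul_hfun (hν : MemD p k ν) (hp0 : 0 < p) (hp1 : p < 1) (i j : Fin k) :
    pmean (J := J) (fun y => ν.real {y})
      (fun x => hfun p (fun l => x l i) * hfun p (fun l => x l j)) =
      pairCorr p ν i j (Fintype.card J) := by
  have := hν.isProbabilityMeasure
  obtain ⟨N, hN⟩ : ∃ N, N = Fintype.card J := ⟨_, rfl⟩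
  obtain ⟨c, hc⟩ : ∃ c, c = pmean (J := J) (bw p) (cosSum p) := ⟨_, rfl⟩
  have hcw : c = (charW (bw p) (fun a : Fin 2 => ((a : ℕ) : ℝ) - p) (1 / √(N : ℝ)) ^ N).re := by
    rw [hc, hN]
    exact pmean_cos (w := bw p) (fun a : Fin 2 => ((a : ℕ) : ℝ) - p) (1 / √(Fintype.card J : ℝ))
  have hcν : ∀ i : Fin k, pmean (J := J) (fun y => ν.real {y})
      (fun x => cosSum p (fun l => x l i)) = c := by
    intro i
    rw [hcw, ← hν.charW_marginal hp0 hp1 i, hN]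
    exact pmean_cos (w := fun y => ν.real {y}) (cent p i) (1 / √(Fintype.card J : ℝ))
  -- Product-to-sum formula: the pair correlation reduces to the characteristic functions of the sum
  -- and of the difference.
  have hcos : ∀ x : J → Fin k → Fin 2, cosSum p (fun l => x l i) * cosSum p (fun l => x l j) =
      1 / 2 * (Real.cos (1 / √(Fintype.card J : ℝ) * ∑ l, (cent p i (x l) + cent p j (x l))) +
        Real.cos (1 / √(Fintype.card J : ℝ) * ∑ l, (cent p i (x l) - cent p j (x l)))) := by
    intro x
    rw [Finset.sum_add_distrib, Finset.sum_sub_distrib, mul_add (1 / √_), mul_sub, Real.cos_add,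
      Real.cos_sub]
    simp only [cosSum, cent]
    ring
  have hexp : ∀ x : J → Fin k → Fin 2, hfun p (fun l => x l i) * hfun p (fun l => x l j) =
      (cosSum p (fun l => x l i) * cosSum p (fun l => x l j) - c * cosSum p (fun l => x l i)) -
        (c * cosSum p (fun l => x l j) - c ^ 2) := by
    intro x
    simp only [hfun, ← hc]
    ring
  simp only [hexp, hcos]
  rw [pmean_sub, pmean_sub, pmean_sub, pmean_const_mul, pmean_const_mul, pmean_const_mul,
    pmean_add, hcν, hcν, pmean_const (sum_real_singleton ν),
    pmean_cos (fun y => cent p i y + cent p j y), pmean_cos (fun y => cent p i y - cent p j y),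
    pairCorr, ← hN, ← hcw]
  ring

/-- The centred sum and difference have variances `2p(1-p) ± 2τ`. Averaging the two Gaussian limits
turns `exp(±τ)` into `cosh τ`; the squared mean supplies the `-1`. -/
theorem MemD.tendsto_pairCorr (hν : MemD p k ν) (hp0 : 0 < p) (hp1 : p < 1) (i j : Fin k) :
    Tendsto (pairCorr p ν i j) atTop
      (𝓝 (Real.exp (-(p * (1 - p))) * (Real.cosh (covW p ν i j) - 1))) := by
  have := hν.isProbabilityMeasure
  have hw := sum_real_singleton ν
  have hi := hν.sum_mul_cent hp0 hp1 i
  have hj := hν.sum_mul_cent hp0 hp1 j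
  have vi := hν.covW_self hp0 hp1 i
  have vj := hν.covW_self hp0 hp1 j
  have t1 := tendsto_charW_pow hw (fun y => cent p i y + cent p j y)
    (by simp only [mul_add, Finset.sum_add_distrib, hi, hj, add_zero])
  have t2 := tendsto_charW_pow hw (fun y => cent p i y - cent p j y)
    (by simp only [mul_sub, Finset.sum_sub_distrib, hi, hj, sub_zero])
  have t3 := tendsto_charW_pow (sum_bw p) (fun a : Fin 2 => ((a : ℕ) : ℝ) - p)
    (by simp [bw]; ring)
  have s1 : ∑ y, ν.real {y} * (cent p i y + cent p j y) ^ 2 =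
      2 * (p * (1 - p)) + 2 * covW p ν i j := by
    rw [two_mul (p * (1 - p))]
    nth_rewrite 1 [← vi]
    rw [← vj]
    simp only [covW, Finset.mul_sum, ← Finset.sum_add_distrib]
    exact Finset.sum_congr rfl fun y _ => by ring
  have s2 : ∑ y, ν.real {y} * (cent p i y - cent p j y) ^ 2 =
      2 * (p * (1 - p)) - 2 * covW p ν i j := by
    rw [two_mul (p * (1 - p))]
    nth_rewrite 1 [← vi]
    rw [← vj]
    simp only [covW, Finset.mul_sum, ← Finset.sum_add_distrib, ← Finset.sum_sub_distrib]
    exact Finset.sum_congr rfl fun y _ => by ring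
  have s3 : ∑ a : Fin 2, bw p a * (((a : ℕ) : ℝ) - p) ^ 2 = p * (1 - p) := by
    simp [bw]; ring
  rw [s1] at t1
  rw [s2] at t2
  rw [s3] at t3
  have t := ((t1.add t2).div_const 2).sub (t3.pow 2)
  have e1 : Real.exp (-(2 * (p * (1 - p)) + 2 * covW p ν i j) / 2) =
      Real.exp (-(p * (1 - p))) * Real.exp (-covW p ν i j) := by
    rw [← Real.exp_add]; ring_nf
  have e2 : Real.exp (-(2 * (p * (1 - p)) - 2 * covW p ν i j) / 2) =
      Real.exp (-(p * (1 - p))) * Real.exp (covW p ν i j) := by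
    rw [← Real.exp_add]; ring_nf
  have e3 : Real.exp (-(p * (1 - p)) / 2) ^ 2 = Real.exp (-(p * (1 - p))) := by
    rw [sq, ← Real.exp_add]; ring_nf
  rw [e1, e2, e3] at t
  convert t using 2
  · rfl
  · rw [Real.cosh_eq]
    ring

theorem pairLimit_nonneg (p τ : ℝ) : 0 ≤ Real.exp (-(p * (1 - p))) * (Real.cosh τ - 1) :=
  mul_nonneg (Real.exp_pos _).le (sub_nonneg.2 (Real.one_le_cosh _))

theorem pairLimit_pos (p : ℝ) {τ : ℝ} (hτ : τ ≠ 0) :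
    0 < Real.exp (-(p * (1 - p))) * (Real.cosh τ - 1) :=
  mul_pos (Real.exp_pos _) (sub_pos.2 (Real.one_lt_cosh.2 hτ))

end covariance

/-! ### Polarization over signs -/

/-- The sign `(-1) ^ a` of `a`. -/
def sgn (a : Fin 2) : ℝ := (-1) ^ (a : ℕ)

/-- An index outside the image of `τ` occurs with exponent one, so summing over its sign gives zero.
-/
theorem sum_sgn_prod_of_not_surjective {ι : Type*} [Fintype ι] [DecidableEq ι] {τ : ι → ι}
    (hτ : ¬ Function.Surjective τ) :
    ∑ c : ι → Fin 2, (∏ i, sgn (c i)) * ∏ i, sgn (c (τ i)) = 0 := by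
  simp only [Function.Surjective, not_forall, not_exists] at hτ
  obtain ⟨i₀, hi₀⟩ := hτ
  have h : ∀ c : ι → Fin 2, (∏ i, sgn (c i)) * ∏ i, sgn (c (τ i)) =
      ∏ i, sgn (c i) ^ (1 + (Finset.univ.filter fun i' => τ i' = i).card) := by
    intro c
    simp only [pow_add, pow_one, Finset.prod_mul_distrib]
    congr 1
    rw [← Finset.prod_fiberwise Finset.univ τ]
    refine Finset.prod_congr rfl fun i _ => ?_
    rw [← Finset.prod_const]
    refine Finset.prod_congr rfl fun i' hi' => ?_
    rw [(Finset.mem_filter.1 hi').2]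
  rw [Finset.sum_congr rfl fun c _ => h c,
    sum_pi_prod (fun i a => sgn a ^ (1 + (Finset.univ.filter fun i' => τ i' = i).card))]
  refine Finset.prod_eq_zero (Finset.mem_univ i₀) ?_
  rw [Finset.filter_false_of_mem fun i' _ => hi₀ i']
  simp [sgn]

/-- Polarization: signed averages extract the multilinear part. -/
theorem sum_sgn_mul_prod_sum {ι : Type*} [Fintype ι] [DecidableEq ι] (g : ι → ι → ℝ) :
    ∑ c : ι → Fin 2, (∏ i, sgn (c i)) * ∏ i', ∑ i, sgn (c i) * g i i' =
      2 ^ Fintype.card ι * ∑ σ : Equiv.Perm ι, ∏ i', g (σ i') i' := by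
  have h1 : ∀ c : ι → Fin 2, (∏ i, sgn (c i)) * ∏ i', ∑ i, sgn (c i) * g i i' =
      ∑ τ : ι → ι, ((∏ i, sgn (c i)) * ∏ i', sgn (c (τ i'))) * ∏ i', g (τ i') i' := by
    intro c
    rw [Finset.prod_univ_sum, Fintype.piFinset_univ, Finset.mul_sum]
    exact Finset.sum_congr rfl fun τ _ => by rw [Finset.prod_mul_distrib]; ring
  rw [Finset.sum_congr rfl fun c _ => h1 c, Finset.sum_comm, Finset.mul_sum]
  simp only [← Finset.sum_mul]
  symm
  refine Finset.sum_of_injOn (fun σ : Equiv.Perm ι => (σ : ι → ι))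
    (fun _ _ _ _ h => DFunLike.coe_injective h) (by simp) ?_ ?_
  · intro τ _ hτ
    rw [sum_sgn_prod_of_not_surjective, zero_mul]
    intro hs
    exact hτ ⟨Equiv.ofBijective τ (Finite.surjective_iff_bijective.1 hs), by simp, rfl⟩
  · intro σ _
    congr 1
    have h2 : ∀ c : ι → Fin 2, (∏ i, sgn (c i)) * ∏ i, sgn (c (σ i)) = 1 := by
      intro c
      rw [Equiv.prod_comp σ (fun i => sgn (c i)), ← Finset.prod_mul_distrib]
      refine Finset.prod_eq_one fun i _ => ?_
      simp [sgn, ← mul_pow]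
    rw [Finset.sum_congr rfl fun c _ => h2 c]
    simp

/-! ### Products of block functions -/

section blocks

variable {k : ℕ} {p : ℝ} {J : Type} [Fintype J] [DecidableEq J] (b : J → Fin k)
  (nb : Fin k → Fin k)

/-- The product of `hfun` over the blocks `e` such that `i` is `e` or its neighbour `nb e`. -/
def gfun (p : ℝ) (i : Fin k) (x : J → Fin 2) : ℝ :=
  ∏ e, if i = e ∨ i = nb e then hfun p (fun j : {j // b j = e} => x j) else 1

theorem abs_gfun_le (hp0 : 0 < p) (hp1 : p < 1) (i : Fin k) (x : J → Fin 2) :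
    |gfun b nb p i x| ≤ 2 ^ k := by
  rw [gfun, Finset.abs_prod]
  calc _ ≤ ∏ _e : Fin k, (2 : ℝ) := by
        refine Finset.prod_le_prod (fun _ _ => abs_nonneg _) fun e _ => ?_
        split
        · exact abs_hfun_le hp0 hp1 _
        · norm_num
    _ = 2 ^ k := by simp

theorem prod_sign_blocks (T : Finset J) (x : J → Fin 2) :
    ∏ j ∈ T, (-1 : ℝ) ^ (x j : ℕ) =
      ∏ e, ∏ j ∈ Finset.univ.filter (fun j : {j // b j = e} => (j : J) ∈ T),
        (-1 : ℝ) ^ (x j : ℕ) := by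
  rw [prod_sign_eq, ← (Equiv.sigmaFiberEquiv b).prod_comp, Fintype.prod_sigma]
  exact Finset.prod_congr rfl fun e _ => by rw [Finset.prod_filter]; rfl

/-- The expectation factors over blocks. Block `i` always carries an `hfun` and gives the small
factor; each other block costs at most `2`. -/
theorem abs_pmean_gfun_mul_sign_le (hp0 : 0 < p) (hp1 : p < 1) {C : ℝ}
    (hC : ∀ (J : Type) [Fintype J] [DecidableEq J] (T : Finset J),
      |pmean (J := J) (bw p) (fun x => hfun p x * ∏ j ∈ T, (-1 : ℝ) ^ (x j : ℕ))| ≤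
        C * (1 / √(Fintype.card J : ℝ))) (i : Fin k) (T : Finset J) :
    |pmean (bw p) (fun x => gfun b nb p i x * ∏ j ∈ T, (-1 : ℝ) ^ (x j : ℕ))| ≤
      2 ^ k * (C * (1 / √(Fintype.card {j // b j = i} : ℝ))) := by
  simp only [gfun, prod_sign_blocks b, ← Finset.prod_mul_distrib]
  rw [pmean_prod_blocks b (fun e z => (if i = e ∨ i = nb e then hfun p z else 1) *
    ∏ j ∈ Finset.univ.filter (fun j : {j // b j = e} => (j : J) ∈ T), (-1 : ℝ) ^ (z j : ℕ)),
    Finset.abs_prod, ← Finset.mul_prod_erase _ _ (Finset.mem_univ i), mul_comm]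
  refine mul_le_mul ?_ ?_ (abs_nonneg _) (by positivity)
  · calc _ ≤ ∏ _e ∈ Finset.univ.erase i, (2 : ℝ) := by
          refine Finset.prod_le_prod (fun _ _ => abs_nonneg _) fun e _ => ?_
          refine abs_pmean_le_of_le (bw_nonneg hp0 hp1) (sum_bw p) fun z => ?_
          rw [abs_mul, Finset.abs_prod]
          simp only [abs_neg_one_pow, Finset.prod_const_one, mul_one]
          split
          · exact abs_hfun_le hp0 hp1 _
          · norm_num
      _ ≤ 2 ^ k := by
          rw [Finset.prod_const]
          exact pow_le_pow_right₀ one_le_two ((Finset.card_le_univ _).trans (by simp))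
  · simp only [true_or, if_true]
    exact hC _ _

theorem MemD.pmean_prod_gfun {ν : Measure (Fin k → Fin 2)} (hν : MemD p k ν) (hp0 : 0 < p)
    (hp1 : p < 1) (hnb : ∀ e, nb e ≠ e) (σ : Equiv.Perm (Fin k)) :
    pmean (fun y => ν.real {y}) (fun x : J → Fin k → Fin 2 =>
      ∏ i, gfun b nb p (σ i) (fun j => x j i)) =
      ∏ e, pairCorr p ν (σ.symm e) (σ.symm (nb e)) (Fintype.card {j // b j = e}) := by
  have h : ∀ x : J → Fin k → Fin 2, ∏ i, gfun b nb p (σ i) (fun j => x j i) =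
      ∏ e, (fun z : {j // b j = e} → Fin k → Fin 2 => hfun p (fun l => z l (σ.symm e)) *
        hfun p (fun l => z l (σ.symm (nb e)))) (fun j : {j // b j = e} => x j) := by
    intro x
    simp only [gfun]
    rw [Finset.prod_comm]
    refine Finset.prod_congr rfl fun e _ => ?_
    rw [Finset.prod_ite, Finset.prod_const_one, mul_one]
    -- After permuting, block `e` is seen by exactly two samples, which are distinct because `nb e ≠
    -- e`.
    have hf : Finset.univ.filter (fun i => σ i = e ∨ σ i = nb e) =
        {σ.symm e, σ.symm (nb e)} := by
      ext i
      simp [Equiv.eq_symm_apply]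
    rw [hf, Finset.prod_pair fun h => hnb e (σ.symm.injective h).symm]
  simp only [h]
  rw [pmean_prod_blocks b (fun e (z : {j // b j = e} → Fin k → Fin 2) =>
        hfun p (fun l => z l (σ.symm e)) *
        hfun p (fun l => z l (σ.symm (nb e))))]
  exact Finset.prod_congr rfl fun e _ => hν.pmean_hfun_mul_hfun hp0 hp1 _ _

/-- The permutation sum is the average over `c` of test values weighted by the sign `∏ sgn (c i)`,
so some absolute value is at least as large. -/
theorem exists_sgn_le_abs_pmean {w : (Fin k → Fin 2) → ℝ} (g : Fin k → (J → Fin 2) → ℝ) :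
    ∃ c : Fin k → Fin 2,
      ∑ σ : Equiv.Perm (Fin k), pmean w (fun x => ∏ i, g (σ i) (fun j => x j i)) ≤
        |pmean w (fun x => ∏ i', ∑ i, sgn (c i) * g i (fun j => x j i'))| := by
  by_contra! hlt
  have h1 : ∑ c : Fin k → Fin 2, (∏ i, sgn (c i)) *
      pmean w (fun x => ∏ i', ∑ i, sgn (c i) * g i (fun j => x j i')) =
      2 ^ k * ∑ σ : Equiv.Perm (Fin k), pmean w (fun x => ∏ i, g (σ i) (fun j => x j i)) := by
    simp only [← pmean_const_mul, ← pmean_sum]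
    congr 1
    ext x
    simpa using sum_sgn_mul_prod_sum (fun i i' => g i (fun j => x j i'))
  have h2 := Finset.sum_lt_sum_of_nonempty (Finset.univ_nonempty) fun c _ => hlt c
  rw [Finset.sum_const, Finset.card_univ] at h2
  simp only [Fintype.card_pi, Fintype.card_fin, Finset.prod_const, Finset.card_univ,
    nsmul_eq_mul, Nat.cast_pow, Nat.cast_ofNat] at h2
  rw [← h1] at h2
  refine absurd (Finset.sum_le_sum fun c _ => ?_) (not_le.2 h2)
  refine (le_abs_self _).trans ?_
  rw [abs_mul, Finset.abs_prod]
  simp [sgn]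

end blocks

/-- The residue of `j` modulo `k`, as an element of `Fin k`. -/
def residue {k : ℕ} (hk : 0 < k) {n : ℕ} (j : Fin n) : Fin k := ⟨j % k, Nat.mod_lt _ hk⟩

/-- The numbers `e + k t` with `t < n / k` are distinct members of the class of `e`. -/
theorem tendsto_card_residue {k : ℕ} (hk : 0 < k) (e : Fin k) :
    Tendsto (fun n => Fintype.card {j : Fin n // residue hk j = e}) atTop atTop := by
  refine tendsto_atTop_mono (fun n => ?_) (Nat.tendsto_div_const_atTop hk.ne')
  have hlt : ∀ t : Fin (n / k), (e : ℕ) + k * t < n := fun t => by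
    calc (e : ℕ) + k * t < k + k * t := by have := e.2; omega
      _ = k * (t + 1) := by ring
      _ ≤ k * (n / k) := Nat.mul_le_mul_left _ t.2
      _ ≤ n := Nat.mul_div_le _ _
  let φ : Fin (n / k) → {j : Fin n // residue hk j = e} := fun t =>
    ⟨⟨e + k * t, hlt t⟩, Fin.ext (by simp [residue, Nat.mod_eq_of_lt e.2])⟩
  have hφ : Function.Injective φ := fun s t h => by
    have h1 : (e : ℕ) + k * s = e + k * t := congrArg (fun j : {j : Fin n // residue hk j = e} => ((j : Fin n) : ℕ)) h
    exact Fin.ext (Nat.eq_of_mul_eq_mul_left hk (by omega))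
  simpa using Fintype.card_le_of_injective φ hφ

/-! ### The construction with values in `[-1, 1]` -/

section bounded

variable {k : ℕ} {p : ℝ} {ν : Measure (Fin k → Fin 2)}

theorem chi_mul_chi {n : ℕ} (S : Finset (Fin n)) (x : Fin n → Fin 2) :
    chi Finset.univ x * chi S x = chi Sᶜ x := by
  have h : chi S x * chi S x = 1 := by
    rw [chi, ← Finset.prod_mul_distrib]
    exact Finset.prod_eq_one fun i _ => by simp [← mul_pow]
  have h2 : chi Finset.univ x = chi S x * chi Sᶜ x := (Finset.prod_mul_prod_compl S _).symm
  rw [h2, mul_right_comm, h, one_mul]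

theorem abs_chi {n : ℕ} (S : Finset (Fin n)) (x : Fin n → Fin 2) : |chi S x| = 1 := by
  rw [chi, Finset.abs_prod]; simp

theorem MemD.prod_chi_univ (hν : MemD p k ν) {n : ℕ} (x : Fin n → Fin k → Fin 2)
    (hx : ∀ j, ν.real {x j} ≠ 0) : ∏ i, chi Finset.univ (fun j => x j i) = 1 := by
  have := hν.isProbabilityMeasure
  simp only [chi]
  rw [Finset.prod_comm]
  refine Finset.prod_eq_one fun j _ => ?_
  rw [Finset.prod_pow_eq_pow_sum]
  exact (hν.support_even (x j) fun h => hx j (by simp [measureReal_def, h])).neg_one_pow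

theorem abs_sgn (a : Fin 2) : |sgn a| = 1 := by simp [sgn]

/-- The normalized signed sum of the functions `gfun`, twisted by the full character. -/
def testFun (p : ℝ) (nb : Fin k → Fin k) {n : ℕ} (b : Fin n → Fin k) (c : Fin k → Fin 2)
    (x : Fin n → Fin 2) : ℝ :=
  (k * 2 ^ k : ℝ)⁻¹ * (chi Finset.univ x * ∑ i, sgn (c i) * gfun b nb p i x)

theorem abs_testFun_le (hp0 : 0 < p) (hp1 : p < 1) (nb : Fin k → Fin k) {n : ℕ}
    (b : Fin n → Fin k) (c : Fin k → Fin 2) (x : Fin n → Fin 2) :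
    |testFun p nb b c x| ≤ 1 := by
  have h : |∑ i, sgn (c i) * gfun b nb p i x| ≤ k * 2 ^ k := by
    refine (Finset.abs_sum_le_sum_abs _ _).trans ?_
    calc _ ≤ ∑ _i : Fin k, (2 : ℝ) ^ k := Finset.sum_le_sum fun i _ => by
          rw [abs_mul, abs_sgn, one_mul]; exact abs_gfun_le b nb hp0 hp1 i x
      _ = k * 2 ^ k := by simp
  rw [testFun, abs_mul, abs_mul, abs_chi, one_mul, abs_inv,
    abs_of_nonneg (by positivity : (0 : ℝ) ≤ k * 2 ^ k)]
  exact (mul_le_mul_of_nonneg_left h (by positivity)).trans inv_mul_le_one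

theorem MemD.testValue_testFun (hν : MemD p k ν) (nb : Fin k → Fin k) {n : ℕ}
    (b : Fin n → Fin k) (c : Fin k → Fin 2) :
    testValue ν (testFun p nb b c) = ((k * 2 ^ k : ℝ)⁻¹) ^ k *
      pmean (fun y => ν.real {y})
        (fun x => ∏ i', ∑ i, sgn (c i) * gfun b nb p i (fun j => x j i')) := by
  have := hν.isProbabilityMeasure
  rw [testValue_eq_pmean, ← pmean_const_mul]
  refine pmean_congr fun x hx => ?_
  simp only [testFun, Finset.prod_mul_distrib, hν.prod_chi_univ x hx, Finset.prod_const,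
    Finset.card_univ, Fintype.card_fin, one_mul]

theorem abs_correlation_testFun_le (hp0 : 0 < p) (hp1 : p < 1) {C : ℝ}
    (hC : ∀ (J : Type) [Fintype J] [DecidableEq J] (T : Finset J),
      |pmean (J := J) (bw p) (fun x => hfun p x * ∏ j ∈ T, (-1 : ℝ) ^ (x j : ℕ))| ≤
        C * (1 / √(Fintype.card J : ℝ)))
    (nb : Fin k → Fin k) {n : ℕ} (b : Fin n → Fin k) (c : Fin k → Fin 2) (S : Finset (Fin n)) :
    |correlation p (testFun p nb b c) S| ≤ (k * 2 ^ k : ℝ)⁻¹ *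
      ∑ i, 2 ^ k * (C * (1 / √(Fintype.card {j // b j = i} : ℝ))) := by
  have h : ∀ x, testFun p nb b c x * chi S x =
      (k * 2 ^ k : ℝ)⁻¹ * ∑ i, sgn (c i) * (gfun b nb p i x * ∏ j ∈ Sᶜ, (-1) ^ (x j : ℕ)) := by
    intro x
    change _ = _ * ∑ i, sgn (c i) * (gfun b nb p i x * chi Sᶜ x)
    rw [← chi_mul_chi, testFun, mul_assoc, mul_right_comm, mul_comm (chi _ x * chi _ x),
      Finset.sum_mul]
    simp only [mul_assoc]
  rw [correlation_eq_pmean hp0 hp1]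
  simp only [h]
  rw [pmean_const_mul, pmean_sum, abs_mul, abs_inv,
    abs_of_nonneg (by positivity : (0 : ℝ) ≤ k * 2 ^ k)]
  refine mul_le_mul_of_nonneg_left ?_ (by positivity)
  refine (Finset.abs_sum_le_sum_abs _ _).trans (Finset.sum_le_sum fun i _ => ?_)
  rw [pmean_const_mul, abs_mul, abs_sgn, one_mul]
  exact abs_pmean_gfun_mul_sign_le b nb hp0 hp1 hC i Sᶜ

theorem MemD.failsWithRange_Icc (hk : 1 ≤ k) (hp0 : 0 < p) (hp1 : p < 1) (hν : MemD p k ν)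
    (hno : ∀ i, ¬ IsPairwiseIndepCoord p ν i) : FailsWithRange p ν (Set.Icc (-1) 1) := by
  have hnb : ∀ i, ∃ j, j ≠ i ∧ covW p ν i j ≠ 0 := by
    intro i
    have := hno i
    simp only [IsPairwiseIndepCoord, not_forall] at this
    obtain ⟨j, hj, h⟩ := this
    exact ⟨j, hj, fun h0 => h (by rw [hν.covW_eq hp0 hp1] at h0; linarith)⟩
  choose nb hnb hcov using hnb
  obtain ⟨C, hC⟩ := exists_abs_pmean_hfun_mul_le hp0 hp1
  have hcard := tendsto_card_residue hk
  obtain ⟨a, ha⟩ : ∃ a : Fin k → Fin k → ℝ, a = fun i j =>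
    Real.exp (-(p * (1 - p))) * (Real.cosh (covW p ν i j) - 1) := ⟨_, rfl⟩
  have ha0 : ∀ i j, 0 ≤ a i j := fun i j => ha ▸ pairLimit_nonneg p _
  obtain ⟨S, hS⟩ : ∃ S, S = ∑ σ : Equiv.Perm (Fin k), ∏ e, a (σ.symm e) (σ.symm (nb e)) :=
    ⟨_, rfl⟩
  have hS0 : 0 < S := by
    rw [hS]
    -- The identity permutation pairs `e` with `nb e`, whose covariance is nonzero.
    refine Finset.sum_pos' (fun σ _ => Finset.prod_nonneg fun e _ => ha0 _ _)
      ⟨Equiv.refl _, Finset.mem_univ _, Finset.prod_pos fun e _ => ?_⟩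
    rw [ha]
    exact pairLimit_pos p (hcov e)
  have hlim : Tendsto (fun n => ∑ σ : Equiv.Perm (Fin k), ∏ e,
      pairCorr p ν (σ.symm e) (σ.symm (nb e))
        (Fintype.card {j : Fin n // residue hk j = e})) atTop (𝓝 S) := by
    rw [hS]
    refine tendsto_finsetSum _ fun σ _ => tendsto_finsetProd _ fun e _ => ?_
    rw [ha]
    exact (hν.tendsto_pairCorr hp0 hp1 _ _).comp (hcard e)
  obtain ⟨N, hN⟩ := eventually_atTop.1 (hlim.eventually_const_le (half_lt_self hS0))
  have hk0 : (0 : ℝ) < k * 2 ^ k := by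
    have : (0 : ℝ) < k := by exact_mod_cast hk
    positivity
  refine ⟨((k * 2 ^ k : ℝ)⁻¹) ^ k * (S / 2), by positivity, fun n => (k * 2 ^ k : ℝ)⁻¹ *
      ∑ i, 2 ^ k * (C * (1 / √(Fintype.card {j : Fin n // residue hk j = i} : ℝ))), ?_, N,
      fun n hn => ?_⟩
  · have h0 : ∀ i, Tendsto (fun n =>
        1 / √(Fintype.card {j : Fin n // residue hk j = i} : ℝ)) atTop (𝓝 0) := fun i => by
      simpa [Function.comp_def, Pi.inv_def] using (Real.tendsto_sqrt_atTop.comp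
        (tendsto_natCast_atTop_atTop.comp (hcard i))).inv_tendsto_atTop
    simpa using (tendsto_finsetSum Finset.univ fun i _ =>
      ((h0 i).const_mul C).const_mul ((2 : ℝ) ^ k)).const_mul ((k * 2 ^ k : ℝ)⁻¹)
  · obtain ⟨c, hc⟩ := exists_sgn_le_abs_pmean (w := fun y => ν.real {y})
      (gfun (residue (n := n) hk) nb p)
    refine ⟨testFun p nb (residue hk) c, fun x => abs_le.1 (abs_testFun_le hp0 hp1 _ _ _ _), ?_,
      fun T => abs_correlation_testFun_le hp0 hp1 hC _ _ _ _⟩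
    rw [hν.testValue_testFun, abs_mul, abs_of_nonneg (by positivity)]
    refine mul_le_mul_of_nonneg_left ((hN n hn).trans ?_) (by positivity)
    refine le_trans (le_of_eq ?_) hc
    exact Finset.sum_congr rfl fun σ _ => (hν.pmean_prod_gfun _ nb hp0 hp1 hnb σ).symm

end bounded

/-! ### Independent random rounding -/

section rounding

variable {X : Type*} [Fintype X] [DecidableEq X]

/-- The probability that the random rounding of the value `t ∈ [-1, 1]` is `sgn a`. -/
def roundWt (t : ℝ) (a : Fin 2) : ℝ := (1 + sgn a * t) / 2

theorem sum_roundWt (t : ℝ) : ∑ a, roundWt t a = 1 := by simp [roundWt, sgn]; ring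

theorem sum_roundWt_mul_sgn (t : ℝ) : ∑ a, roundWt t a * sgn a = t := by
  simp [roundWt, sgn]; ring

theorem roundWt_nonneg {t : ℝ} (ht : |t| ≤ 1) (a : Fin 2) : 0 ≤ roundWt t a := by
  rw [abs_le] at ht
  fin_cases a <;> simp [roundWt, sgn] <;> linarith

/-- The expectation over an independent random rounding of the values of `f`. -/
def roundMean (f : X → ℝ) (G : (X → Fin 2) → ℝ) : ℝ :=
  ∑ c : X → Fin 2, (∏ x, roundWt (f x) (c x)) * G c

variable {f : X → ℝ}

theorem roundMean_prod (u : X → Fin 2 → ℝ) :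
    roundMean f (fun c => ∏ x, u x (c x)) = ∏ x, ∑ a, roundWt (f x) a * u x a := by
  simp only [roundMean, ← Finset.prod_mul_distrib]
  exact sum_pi_prod fun x a => roundWt (f x) a * u x a

theorem roundMean_const (c : ℝ) : roundMean f (fun _ => c) = c := by
  simp only [roundMean, ← Finset.sum_mul]
  rw [sum_pi_prod (fun x a => roundWt (f x) a), Finset.prod_eq_one fun x _ => sum_roundWt _,
    one_mul]

theorem roundMean_mono (hf : ∀ x, |f x| ≤ 1) {F G : (X → Fin 2) → ℝ} (h : ∀ c, F c ≤ G c) :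
    roundMean f F ≤ roundMean f G :=
  Finset.sum_le_sum fun c _ => mul_le_mul_of_nonneg_left (h c)
    (Finset.prod_nonneg fun x _ => roundWt_nonneg (hf x) _)

theorem roundMean_sub (F G : (X → Fin 2) → ℝ) :
    roundMean f (fun c => F c - G c) = roundMean f F - roundMean f G := by
  simp [roundMean, mul_sub, Finset.sum_sub_distrib]

theorem roundMean_add (F G : (X → Fin 2) → ℝ) :
    roundMean f (fun c => F c + G c) = roundMean f F + roundMean f G := by
  simp [roundMean, mul_add, Finset.sum_add_distrib]

theorem roundMean_mul_const (a : ℝ) (G : (X → Fin 2) → ℝ) :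
    roundMean f (fun c => G c * a) = roundMean f G * a := by
  simp only [roundMean, Finset.sum_mul, mul_assoc]

theorem roundMean_sum {ι : Type*} (s : Finset ι) (F : ι → (X → Fin 2) → ℝ) :
    roundMean f (fun c => ∑ i ∈ s, F i c) = ∑ i ∈ s, roundMean f (F i) := by
  simp only [roundMean, Finset.mul_sum]
  exact Finset.sum_comm

theorem exists_roundMean_le (hf : ∀ x, |f x| ≤ 1) (G : (X → Fin 2) → ℝ) :
    ∃ c, roundMean f G ≤ G c := by
  obtain ⟨c, -, hc⟩ := Finset.exists_max_image Finset.univ G Finset.univ_nonempty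
  exact ⟨c, (roundMean_mono hf fun c' => hc c' (Finset.mem_univ _)).trans_eq (roundMean_const _)⟩

/-- Distinct points are rounded independently; repeated points would break the factorization. -/
theorem roundMean_prod_sgn {ι : Type*} [Fintype ι] {y : ι → X} (hy : Function.Injective y) :
    roundMean f (fun c => ∏ i, sgn (c (y i))) = ∏ i, f (y i) := by
  have h : ∀ u : X → ℝ, ∏ i, u (y i) = ∏ x, if x ∈ Finset.univ.image y then u x else 1 := by
    intro u
    rw [Finset.prod_ite_mem, Finset.univ_inter, Finset.prod_image fun _ _ _ _ h => hy h]
  simp only [h f, fun c : X → Fin 2 => h fun x => sgn (c x)]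
  rw [roundMean_prod (fun x a => if x ∈ Finset.univ.image y then sgn a else 1)]
  refine Finset.prod_congr rfl fun x _ => ?_
  split
  · exact sum_roundWt_mul_sgn _
  · simp only [mul_one, sum_roundWt]

/-- In `exp y ≤ 1 + y + y^2`, valid for `|y| ≤ 1`, the linear term averages to zero and the square
to `θ^2 (1 - t^2)`. -/
theorem sum_roundWt_exp_le {t θ : ℝ} (ht : |t| ≤ 1) (hθ : 2 * |θ| ≤ 1) :
    ∑ a, roundWt t a * Real.exp (θ * (sgn a - t)) ≤ Real.exp (θ ^ 2) := by
  have key : ∀ a, Real.exp (θ * (sgn a - t)) ≤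
      1 + θ * (sgn a - t) + (θ * (sgn a - t)) ^ 2 := by
    intro a
    have h2 : |sgn a - t| ≤ 2 := (abs_sub _ _).trans (by rw [abs_sgn]; linarith)
    have h1 : |θ * (sgn a - t)| ≤ 1 := by
      rw [abs_mul]; nlinarith [abs_nonneg θ]
    have := (le_abs_self _).trans (Real.norm_exp_sub_one_sub_id_le (x := θ * (sgn a - t)) h1)
    rw [Real.norm_eq_abs, sq_abs] at this
    linarith
  calc _ ≤ ∑ a, roundWt t a * (1 + θ * (sgn a - t) + (θ * (sgn a - t)) ^ 2) :=
        Finset.sum_le_sum fun a _ => mul_le_mul_of_nonneg_left (key a) (roundWt_nonneg ht a)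
    _ = 1 + θ ^ 2 * (1 - t ^ 2) := by simp [roundWt, sgn]; ring
    _ ≤ θ ^ 2 + 1 := by nlinarith [sq_nonneg θ, sq_nonneg t, mul_nonneg (sq_nonneg θ) (sq_nonneg t)]
    _ ≤ Real.exp (θ ^ 2) := Real.add_one_le_exp _

theorem roundMean_exp_le (hf : ∀ x, |f x| ≤ 1) {l W : ℝ} {m : X → ℝ}
    (hm : ∀ x, 2 * |l * m x| ≤ 1) (hW : ∑ x, m x ^ 2 ≤ W) :
    roundMean f (fun c => Real.exp (l * ∑ x, m x * (sgn (c x) - f x))) ≤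
      Real.exp (l ^ 2 * W) := by
  simp only [Finset.mul_sum, Real.exp_sum, ← mul_assoc]
  rw [roundMean_prod (fun x a => Real.exp (l * m x * (sgn a - f x)))]
  calc _ ≤ ∏ x, Real.exp ((l * m x) ^ 2) := Finset.prod_le_prod
        (fun x _ => Finset.sum_nonneg fun a _ =>
          mul_nonneg (roundWt_nonneg (hf x) a) (Real.exp_pos _).le)
        (fun x _ => sum_roundWt_exp_le (hf x) (hm x))
    _ ≤ Real.exp (l ^ 2 * W) := by
        rw [← Real.exp_sum]
        simp only [mul_pow, ← Finset.mul_sum]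
        gcongr

/-- A bounded function can be rounded to a sign function so that a given functional stays large
and finitely many linear functionals are almost unchanged. -/
theorem exists_rounding {I : Type*} [Fintype I] (hf : ∀ x, |f x| ≤ 1)
    (V : (X → ℝ) → ℝ) {α l W ε : ℝ} (hα : 0 < α) (hαV : α ≤ |V f|)
    (hV1 : ∀ c : X → Fin 2, |V fun x => sgn (c x)| ≤ 1)
    (hη : |roundMean f (fun c => V fun x => sgn (c x)) - V f| ≤ α / 4)
    (m : I → X → ℝ) (hl : 0 < l) (hm : ∀ i x, 2 * (l * |m i x|) ≤ 1)
    (hW : ∀ i, ∑ x, m i x ^ 2 ≤ W)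
    (hcard : Fintype.card I * (2 * Real.exp (l ^ 2 * W - l * ε)) ≤ α / 4) :
    ∃ c : X → Fin 2, α / 2 ≤ |V fun x => sgn (c x)| ∧
      ∀ i, |∑ x, m i x * (sgn (c x) - f x)| ≤ ε := by
  obtain ⟨σ, hσ, hσV⟩ : ∃ σ : ℝ, |σ| = 1 ∧ |V f| = V f * σ := by
    rcases abs_choice (V f) with h | h
    · exact ⟨1, by simp, by rw [h, mul_one]⟩
    · exact ⟨-1, by simp, by rw [h, mul_neg_one]⟩
  let L : I → (X → Fin 2) → ℝ := fun i c => ∑ x, m i x * (sgn (c x) - f x)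
  -- Exponential penalty for all deviations at once; subtracting it from the signed test value lets
  -- one outcome satisfy every requirement.
  let B : (X → Fin 2) → ℝ := fun c =>
    ∑ i, (Real.exp (l * L i c) + Real.exp (-l * L i c)) * Real.exp (-(l * ε))
  have hB : roundMean f B ≤ α / 4 := by
    refine le_trans ?_ hcard
    simp only [B]
    rw [roundMean_sum, ← nsmul_eq_mul, ← Finset.card_univ, ← Finset.sum_const]
    refine Finset.sum_le_sum fun i _ => ?_
    rw [roundMean_mul_const, roundMean_add, sub_eq_add_neg, Real.exp_add, ← mul_assoc]
    refine mul_le_mul_of_nonneg_right ?_ (Real.exp_pos _).le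
    have h1 := roundMean_exp_le (l := l) hf (m := m i)
      (fun x => by rw [abs_mul, abs_of_pos hl]; exact hm i x) (hW i)
    have h2 := roundMean_exp_le (l := -l) hf (m := m i)
      (fun x => by rw [abs_mul, abs_neg, abs_of_pos hl]; exact hm i x) (hW i)
    rw [neg_sq] at h2
    simp only [L]
    linarith
  obtain ⟨c, hc⟩ := exists_roundMean_le hf fun c => (V fun x => sgn (c x)) * σ - B c
  rw [roundMean_sub, roundMean_mul_const] at hc
  have hmain : α / 2 ≤ (V fun x => sgn (c x)) * σ - B c := by
    refine le_trans ?_ hc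
    have : |roundMean f (fun c => V fun x => sgn (c x)) * σ - V f * σ| ≤ α / 4 := by
      rwa [← sub_mul, abs_mul, hσ, mul_one]
    have := (abs_le.1 this).1
    linarith
  have hVle : (V fun x => sgn (c x)) * σ ≤ |V fun x => sgn (c x)| :=
    (le_abs_self _).trans_eq (by rw [abs_mul, hσ, mul_one])
  have hB0 : ∀ i, 0 ≤ (Real.exp (l * L i c) + Real.exp (-l * L i c)) * Real.exp (-(l * ε)) :=
    fun i => by positivity
  have hBc : 0 ≤ B c := Finset.sum_nonneg fun i _ => hB0 i
  refine ⟨c, by linarith, fun i => ?_⟩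
  -- The signed test value is at most `1` and exceeds the penalty, so each summand of the penalty is
  -- at most `1`.
  have hi : (Real.exp (l * L i c) + Real.exp (-l * L i c)) * Real.exp (-(l * ε)) ≤ 1 := by
    have := Finset.single_le_sum (fun i _ => hB0 i) (Finset.mem_univ i)
    have := hV1 c
    change _ ≤ B c at *
    linarith
  have hone : ∀ t, Real.exp t * Real.exp (-(l * ε)) ≤ 1 → t ≤ l * ε := by
    intro t ht
    rw [← Real.exp_add, Real.exp_le_one_iff] at ht
    linarith
  have e1 := (Real.exp_pos (l * L i c)).le
  have e2 := (Real.exp_pos (-l * L i c)).le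
  have e3 := (Real.exp_pos (-(l * ε))).le
  have h1 := hone (l * L i c) (le_trans (mul_le_mul_of_nonneg_right (by linarith) e3) hi)
  have h2 := hone (-l * L i c) (le_trans (mul_le_mul_of_nonneg_right (by linarith) e3) hi)
  rw [abs_le]
  exact ⟨by nlinarith, le_of_mul_le_mul_left h1 hl⟩

end rounding

/-! ### Sign-valued functions -/

section signs

variable {k : ℕ} {p : ℝ} {ν : Measure (Fin k → Fin 2)}

/-- The probability that two coordinates of `ν` agree. -/
def agreeProb (ν : Measure (Fin k → Fin 2)) (i j : Fin k) : ℝ :=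
  ∑ y, ν.real {y} * if y i = y j then 1 else 0

theorem agreeProb_nonneg (i j : Fin k) : 0 ≤ agreeProb ν i j :=
  Finset.sum_nonneg fun y _ => by split <;> simp

theorem agreeProb_lt_one [IsProbabilityMeasure ν] {i j : Fin k} (h : ν {x | x i = x j} < 1) :
    agreeProb ν i j < 1 := by
  have e : agreeProb ν i j = ν.real {x | x i = x j} := by
    have := sum_measureReal_singleton (μ := ν) (Finset.univ.filter fun x : Fin k → Fin 2 => x i = x j)
    rw [Finset.coe_filter_univ] at this
    rw [← this, agreeProb, Finset.sum_filter]
    simp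
  rw [e, measureReal_def]
  exact (ENNReal.toReal_lt_of_lt_ofReal (by simpa using h))

/-- Rounding is exact unless two of the vectors `X_i` coincide, and then the error is at most `2`; a
union bound over pairs finishes. -/
theorem abs_roundMean_testValue_sub_le [IsProbabilityMeasure ν] {n : ℕ} {f : (Fin n → Fin 2) → ℝ}
    (hf : ∀ x, |f x| ≤ 1) :
    |roundMean f (fun c => testValue ν fun x => sgn (c x)) - testValue ν f| ≤
      ∑ i, ∑ j, if i = j then 0 else 2 * agreeProb ν i j ^ n := by
  have h0 : ∀ y : Fin k → Fin 2, 0 ≤ ν.real {y} := fun _ => measureReal_nonneg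
  have hcomm : roundMean f (fun c => testValue ν fun x => sgn (c x)) =
      pmean (fun y => ν.real {y}) (fun x : Fin n → Fin k → Fin 2 =>
        roundMean f fun c => ∏ i, sgn (c fun l => x l i)) := by
    simp only [testValue_eq_pmean, pmean, roundMean, Finset.mul_sum]
    rw [Finset.sum_comm]
    exact Finset.sum_congr rfl fun _ _ => Finset.sum_congr rfl fun _ _ => by ring
  rw [hcomm, testValue_eq_pmean, ← pmean_sub]
  refine (abs_pmean_le h0 _).trans ?_
  have hpt : ∀ x : Fin n → Fin k → Fin 2,
      |(roundMean f fun c => ∏ i, sgn (c fun l => x l i)) - ∏ i, f fun l => x l i| ≤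
        ∑ i, ∑ j, (if i = j then 0 else 2) * ∏ l, if x l i = x l j then (1 : ℝ) else 0 := by
    intro x
    have hnn : ∀ i j, 0 ≤ (if i = j then 0 else 2) * ∏ l, if x l i = x l j then (1 : ℝ) else 0 :=
      fun i j => mul_nonneg (by split <;> norm_num)
        (Finset.prod_nonneg fun l _ => by split <;> norm_num)
    by_cases hx : Function.Injective fun i l => x l i
    · rw [roundMean_prod_sgn hx, sub_self, abs_zero]
      exact Finset.sum_nonneg fun i _ => Finset.sum_nonneg fun j _ => hnn i j
    · simp only [Function.Injective, not_forall] at hx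
      obtain ⟨i, j, hij, hne⟩ := hx
      have h1 : |roundMean f fun c => ∏ i, sgn (c fun l => x l i)| ≤ 1 := by
        have hb : ∀ c : (Fin n → Fin 2) → Fin 2, |∏ i, sgn (c fun l => x l i)| ≤ 1 := fun c => by
          rw [Finset.abs_prod]; simp [abs_sgn]
        rw [abs_le]
        constructor
        · exact (roundMean_const (f := f) (-1)).symm.trans_le
            (roundMean_mono hf fun c => (abs_le.1 (hb c)).1)
        · exact (roundMean_mono hf fun c => (abs_le.1 (hb c)).2).trans_eq (roundMean_const 1)
      have h2 : |∏ i, f fun l => x l i| ≤ 1 := by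
        rw [Finset.abs_prod]
        exact Finset.prod_le_one (fun _ _ => abs_nonneg _) fun _ _ => hf _
      calc _ ≤ (2 : ℝ) := (abs_sub _ _).trans (by linarith)
        _ = (if i = j then 0 else 2) * ∏ l, if x l i = x l j then (1 : ℝ) else 0 := by
            rw [if_neg hne, Finset.prod_eq_one, mul_one]
            intro l _
            rw [if_pos (congrFun hij l)]
        _ ≤ ∑ j, (if i = j then 0 else 2) * ∏ l, if x l i = x l j then (1 : ℝ) else 0 :=
            Finset.single_le_sum (fun j _ => hnn i j) (Finset.mem_univ j)
        _ ≤ _ := Finset.single_le_sum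
            (f := fun i => ∑ j, (if i = j then 0 else 2) * ∏ l, if x l i = x l j then (1 : ℝ) else 0)
            (fun i _ => Finset.sum_nonneg fun j _ => hnn i j) (Finset.mem_univ i)
  refine (pmean_mono h0 hpt).trans_eq ?_
  simp only [pmean_sum, pmean_const_mul]
  refine Finset.sum_congr rfl fun i _ => Finset.sum_congr rfl fun j _ => ?_
  rw [pmean_prod (fun _ (y : Fin k → Fin 2) => if y i = y j then (1 : ℝ) else 0),
    Finset.prod_const, Finset.card_univ, Fintype.card_fin, ite_mul, zero_mul]
  rfl

theorem exists_sign_rounding (hp0 : 0 < p) (hp1 : p < 1) [IsProbabilityMeasure ν] {n : ℕ}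
    {f : (Fin n → Fin 2) → ℝ} (hf : ∀ x, |f x| ≤ 1) {α q : ℝ} (hα : 0 < α)
    (hαf : α ≤ |testValue ν f|) (hq0 : 0 < q) (hpq : p ≤ q ^ 2) (hpq' : 1 - p ≤ q ^ 2)
    (hη : ∑ i : Fin k, ∑ j, (if i = j then 0 else 2 * agreeProb ν i j ^ n) ≤ α / 4)
    (hqn : 2 * q ^ n ≤ 1) (hn : 2 * Real.exp (1 - n) ≤ α / 4) :
    ∃ F : (Fin n → Fin 2) → ℝ, (∀ x, F x ∈ ({-1, 1} : Set ℝ)) ∧ α / 2 ≤ |testValue ν F| ∧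
      ∀ S, |correlation p F S - correlation p f S| ≤ 2 * n * q ^ n := by
  have hbw : ∀ a, bw p a ≤ q ^ 2 := fun a => by unfold bw; split <;> assumption
  have hqn0 : 0 < q ^ n := pow_pos hq0 n
  have hμ0 : ∀ x : Fin n → Fin 2, 0 ≤ ∏ j, bw p (x j) := fun x =>
    Finset.prod_nonneg fun j _ => bw_nonneg hp0 hp1 _
  have hμ : ∀ x : Fin n → Fin 2, ∏ j, bw p (x j) ≤ (q ^ n) ^ 2 := fun x => by
    calc _ ≤ ∏ _j : Fin n, q ^ 2 :=
          Finset.prod_le_prod (fun j _ => bw_nonneg hp0 hp1 _) fun j _ => hbw _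
      _ = (q ^ n) ^ 2 := by simp [← pow_mul, mul_comm]
  have hμ1 : ∑ x : Fin n → Fin 2, ∏ j, bw p (x j) = 1 := by
    rw [sum_pi_prod (fun (_ : Fin n) a => bw p a), Finset.prod_eq_one fun _ _ => sum_bw p]
  have hV1 : ∀ c : (Fin n → Fin 2) → Fin 2, |testValue ν fun x => sgn (c x)| ≤ 1 := by
    intro c
    rw [testValue_eq_pmean]
    refine abs_pmean_le_of_le (fun _ => measureReal_nonneg) (sum_real_singleton ν) fun x => ?_
    rw [Finset.abs_prod]
    simp [abs_sgn]
  have hm : ∀ (S : Finset (Fin n)) x, 2 * ((q ^ n)⁻¹ * |(∏ j, bw p (x j)) * chi S x|) ≤ 1 := by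
    intro S x
    rw [abs_mul, abs_chi, mul_one, abs_of_nonneg (hμ0 x)]
    refine le_trans ?_ hqn
    have : (q ^ n)⁻¹ * ∏ j, bw p (x j) ≤ q ^ n := by
      rw [inv_mul_le_iff₀ hqn0, ← sq]; exact hμ x
    linarith
  have hW : ∀ S : Finset (Fin n), ∑ x, ((∏ j, bw p (x j)) * chi S x) ^ 2 ≤ (q ^ n) ^ 2 := by
    intro S
    calc _ ≤ ∑ x : Fin n → Fin 2, (q ^ n) ^ 2 * ∏ j, bw p (x j) := by
          refine Finset.sum_le_sum fun x _ => ?_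
          rw [mul_pow, ← sq_abs (chi S x), abs_chi, one_pow, mul_one, sq]
          exact mul_le_mul_of_nonneg_right (hμ x) (hμ0 x)
      _ = (q ^ n) ^ 2 := by rw [← Finset.mul_sum, hμ1, mul_one]
  -- Atoms have mass at most `q^(2n)`, so `l = q^(-n)` and `W = q^(2n)` give `l^2 W = 1`; the
  -- tolerance `2n q^n` gives `exp(1 - 2n)`, which beats the `2^n` characters.
  have hcard : Fintype.card (Finset (Fin n)) *
      (2 * Real.exp (((q ^ n)⁻¹) ^ 2 * (q ^ n) ^ 2 - (q ^ n)⁻¹ * (2 * n * q ^ n))) ≤ α / 4 := by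
    refine le_trans ?_ hn
    have e1 : ((q ^ n)⁻¹) ^ 2 * (q ^ n) ^ 2 - (q ^ n)⁻¹ * (2 * n * q ^ n) = (1 - n) - n := by
      field_simp
      ring
    have e2 : (2 : ℝ) ^ n ≤ Real.exp n := by
      rw [← Real.exp_one_pow]
      refine pow_le_pow_left₀ (by norm_num) ?_ n
      have := Real.add_one_le_exp (1 : ℝ)
      linarith
    rw [e1, Real.exp_sub (1 - (n : ℝ)) n, Fintype.card_finset, Fintype.card_fin]
    push_cast
    rw [mul_div_assoc', mul_div_assoc', div_le_iff₀ (Real.exp_pos _), mul_comm]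
    exact mul_le_mul_of_nonneg_left e2 (by positivity)
  obtain ⟨c, hc, hcS⟩ := exists_rounding hf (testValue ν) hα hαf hV1
    ((abs_roundMean_testValue_sub_le hf).trans hη)
    (fun S x => (∏ j, bw p (x j)) * chi S x) (inv_pos.2 hqn0) hm hW hcard
  refine ⟨fun x => sgn (c x), fun x => (neg_one_pow_eq_or ℝ _).symm, hc, fun S => ?_⟩
  rw [correlation_eq_pmean hp0 hp1, correlation_eq_pmean hp0 hp1, ← pmean_sub]
  refine le_trans (le_of_eq (congrArg abs (Finset.sum_congr rfl fun x _ => ?_))) (hcS S)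
  ring

theorem failsWithRange_signs (hp0 : 0 < p) (hp1 : p < 1) [IsProbabilityMeasure ν]
    (hne : ∀ i j : Fin k, i ≠ j → ν {x | x i = x j} < 1)
    (h : FailsWithRange p ν (Set.Icc (-1) 1)) : FailsWithRange p ν {-1, 1} := by
  obtain ⟨α, hα, ε, hε, N, hN⟩ := h
  -- `q^2` is the larger atom of `μ_p`, so `q < 1` and the rounding error `2n q^n` vanishes.
  obtain ⟨q, hq⟩ : ∃ q, q = √(max p (1 - p)) := ⟨_, rfl⟩
  have hr0 : 0 < max p (1 - p) := lt_max_of_lt_left hp0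
  have hq0 : 0 < q := hq ▸ Real.sqrt_pos.2 hr0
  have hq2 : q ^ 2 = max p (1 - p) := by rw [hq, Real.sq_sqrt hr0.le]
  have hq1 : q < 1 := by
    rw [hq, Real.sqrt_lt' one_pos, one_pow]
    exact max_lt hp1 (by linarith)
  have hlim1 : Tendsto (fun n : ℕ => ∑ i : Fin k, ∑ j, if i = j then 0 else
      2 * agreeProb ν i j ^ n) atTop (𝓝 0) := by
    have : Tendsto (fun n : ℕ => ∑ i : Fin k, ∑ j, if i = j then 0 else
        2 * agreeProb ν i j ^ n) atTop (𝓝 (∑ i : Fin k, ∑ j : Fin k, 0)) := by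
      refine tendsto_finsetSum _ fun i _ => tendsto_finsetSum _ fun j _ => ?_
      split
      · exact tendsto_const_nhds
      · rename_i hij
        simpa using (tendsto_pow_atTop_nhds_zero_of_lt_one (agreeProb_nonneg i j)
          (agreeProb_lt_one (hne i j hij))).const_mul 2
    simpa using this
  have hlim2 : Tendsto (fun n : ℕ => 2 * q ^ n) atTop (𝓝 0) := by
    simpa using (tendsto_pow_atTop_nhds_zero_of_lt_one hq0.le hq1).const_mul 2
  have hlim3 : Tendsto (fun n : ℕ => 2 * Real.exp (1 - n)) atTop (𝓝 0) := by
    have : Tendsto (fun n : ℕ => (1 : ℝ) - n) atTop atBot :=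
      tendsto_atBot_add_const_left _ 1 (tendsto_neg_atTop_atBot.comp tendsto_natCast_atTop_atTop)
    simpa using (Real.tendsto_exp_atBot.comp this).const_mul 2
  have hlim4 : Tendsto (fun n : ℕ => 2 * (n : ℝ) * q ^ n) atTop (𝓝 0) := by
    have := (tendsto_self_mul_const_pow_of_lt_one hq0.le hq1).const_mul 2
    simpa [mul_assoc] using this
  obtain ⟨M, hM⟩ := eventually_atTop.1 ((hlim1.eventually_le_const (u := α / 4) (by positivity)).and
    ((hlim2.eventually_le_const one_pos).and
      (hlim3.eventually_le_const (u := α / 4) (by positivity))))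
  refine ⟨α / 2, by positivity, fun n => ε n + 2 * (n : ℝ) * q ^ n,
    by simpa using hε.add hlim4, max N M, fun n hn => ?_⟩
  obtain ⟨f, hf, hfα, hfS⟩ := hN n ((le_max_left _ _).trans hn)
  obtain ⟨h1, h2, h3⟩ := hM n ((le_max_right _ _).trans hn)
  obtain ⟨F, hF, hFα, hFS⟩ := exists_sign_rounding hp0 hp1 (fun x => abs_le.2 (hf x)) hα hfα hq0
    (hq2 ▸ le_max_left _ _) (hq2 ▸ le_max_right _ _) h1 h2 h3
  refine ⟨F, hF, hFα, fun S => ?_⟩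
  calc |correlation p F S| = |correlation p f S + (correlation p F S - correlation p f S)| := by
        ring_nf
    _ ≤ _ := (abs_add_le _ _).trans (add_le_add (hfS S) (hFS S))

end signs

end LinTest

end

theorem theorem4p1 (k : ℕ) (hk : 1 ≤ k) (p : ℝ) (hp0 : 0 < p) (hp1 : p < 1)
    (ν : Measure (Fin k → Fin 2)) (hν : LinTest.MemD p k ν)
    (hno : ∀ i : Fin k, ¬ LinTest.IsPairwiseIndepCoord p ν i) :
    LinTest.FailsWithRange p ν (Set.Icc (-1) 1) ∧
      ((∀ i j : Fin k, i ≠ j → ν {x | x i = x j} < 1) →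
        LinTest.FailsWithRange p ν {-1, 1}) := by
  have := hν.isProbabilityMeasure
  have h := hν.failsWithRange_Icc hk hp0 hp1 hno
  exact ⟨h, fun hne => LinTest.failsWithRange_signs hp0 hp1 hne h⟩
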